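/- Let $T$ be a nonempty string of length $n$ over an arbitrary alphabet (linearly ordered wherever the Burrows-Wheeler transform is used). Let $z$ be the number of phrases of the LZ77 parse of $T$ without self-references and without trailing characters: scanning $T$ from left to right, the next phrase is the longest prefix of the remaining text that occurs entirely inside the part of $T$ already parsed, or a single letter if the next letter does not occur in that part. Let $b^*$ be the size of the smallest macro scheme of $T$. Here a macro scheme of size $b$ is a set of $b$ directives, each of the form $T[i..j]\leftarrow T[i'..j']$ with $j-i=j'-i'\ge 0$ or $T[i]\leftarrow c$ with $c$ a letter, which are all correct for $T$ and from which $T$ can be unambiguously reconstructed, i.e. each position of $T$ is linked to an explicitly given letter by a finite chain of copies. Left-hand sides may overlap, and sources may lie on either side of their targets. Let $r$ be the number of maximal equal-letter runs in the Burrows-Wheeler transform of $T$, which is the last column of the $n\times n$ matrix whose rows are the $n$ circular rotations of $T$ in lexicographic order. Then there are absolute constants $C_1,C_2>0$, independent of $T$ and of the alphabet, such that for every such $T$: 1. $z \le C_1\, b^*\log_2^2(2n/b^*)$, and 2. $z \le C_2\, r\log_2^2(2n/r)$. Equivalently, $z\in\mathcal O(b^*\log^2(n/b^*))$ and $z\in\mathcal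 O(r\log^2(n/r))$, with the usual convention that $\log x$ stands for $1+\log_2 x$, so that the logarithmic factor never drops below $1$. -/

import Mathlib

namespace StringCompression

/-! Strings over an alphabet `α` are lists; positions are counted from `0`. -/

section LZ77

variable {α : Type*} [DecidableEq α]

/-- Length of the longest prefix of `s` that occurs inside `w`. -/
def longestPrevLength (w s : List α) : ℕ :=
  Nat.findGreatest (fun l => s.take l <:+: w) s.length

/-- The phrases of the greedy Lempel-Ziv parse, without self-references and without trailing
characters, of the remaining text `s` when `w` is the part already parsed: the next phrase is the
longest prefix of `s` that occurs entirely inside `w`, or a single letter if the first letter of `s`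
does not occur in `w`. -/
def lz77From (w s : List α) : List (List α) :=
  match s with
  | [] => []
  | a :: t =>
    let l := max 1 (longestPrevLength w (a :: t))
    (a :: t).take l :: lz77From (w ++ (a :: t).take l) ((a :: t).drop l)
termination_by s.length
decreasing_by
  simp only [List.length_drop, List.length_cons]
  omega

/-- The LZ77 parse of `T` without self-references and without trailing characters. -/
def lz77Parse (T : List α) : List (List α) := lz77From [] T

/-- The number `z` of phrases of the LZ77 parse without self-references. -/
def lz77Size (T : List α) : ℕ := (lz77Parse T).length

end LZ77

section MacroScheme

variable {α : Type*}

/-- The directives of a macro scheme. -/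
inductive Directive (α : Type*) where
  /-- `T[dst .. dst + len - 1] ← T[src .. src + len - 1]` -/
  | copy (dst src len : ℕ) : Directive α
  /-- `T[pos] ← c` -/
  | literal (pos : ℕ) (c : α) : Directive α

/-- The directive refers to (nonempty ranges of) positions of `T`, and is correct for `T`. -/
def Directive.HoldsIn (T : List α) : Directive α → Prop
  | .copy dst src len => 0 < len ∧ dst + len ≤ T.length ∧ src + len ≤ T.length ∧
      ∀ k < len, T[dst + k]? = T[src + k]?
  | .literal pos c => T[pos]? = some c

/-- The character at a position can be retrieved from the directives: it is given explicitly, or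
it is copied from a position whose character can be retrieved. -/
inductive Retrievable (D : Finset (Directive α)) : ℕ → Prop
  | literal {pos : ℕ} {c : α} (h : Directive.literal pos c ∈ D) : Retrievable D pos
  | copy {dst src len k : ℕ} (h : Directive.copy dst src len ∈ D) (hk : k < len)
      (hsrc : Retrievable D (src + k)) : Retrievable D (dst + k)

/-- `D` is a macro scheme of `T`: all its directives are correct for `T`, and every character of `T`
is reconstructed by finitely many copies from an explicitly given character. Left-hand sides may
overlap, and sources may lie on either side of their targets. -/
def IsMacroScheme (D : Finset (Directive α)) (T : List α) : Prop :=
  (∀ d ∈ D, d.HoldsIn T) ∧ ∀ i < T.length, Retrievable D i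

/-- The size `b*` of the smallest macro scheme of `T`. -/
noncomputable def minMacroSchemeSize (T : List α) : ℕ :=
  sInf {b : ℕ | ∃ D : Finset (Directive α), IsMacroScheme D T ∧ D.card = b}

/-- Every string has a macro scheme, so the infimum above is attained. -/
theorem exists_isMacroScheme_card_eq (T : List α) :
    ∃ D : Finset (Directive α), IsMacroScheme D T ∧ D.card = minMacroSchemeSize T := by
  classical
  apply Nat.sInf_mem (s := {b : ℕ | ∃ D : Finset (Directive α), IsMacroScheme D T ∧ D.card = b})
  let D : Finset (Directive α) :=
    Finset.univ.image (fun i : Fin T.length => Directive.literal i.1 (T.get i))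
  refine ⟨D.card, D, ⟨?_, ?_⟩, rfl⟩
  · intro d hd
    obtain ⟨i, -, rfl⟩ := Finset.mem_image.1 hd
    simp [Directive.HoldsIn]
  · intro i hi
    exact .literal (Finset.mem_image.2 ⟨⟨i, hi⟩, Finset.mem_univ _, rfl⟩)

/-- A macro scheme of `T` determines `T` unambiguously. -/
theorem IsMacroScheme.unique {D : Finset (Directive α)} {T T' : List α} (h : IsMacroScheme D T)
    (hlen : T'.length = T.length) (h' : ∀ d ∈ D, d.HoldsIn T') : T' = T := by
  have key : ∀ i, Retrievable D i → T'[i]? = T[i]? := by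
    intro i hi
    induction hi with
    | literal hd => exact (h' _ hd).trans (h.1 _ hd).symm
    | copy hd hk _ ih =>
      exact ((h' _ hd).2.2.2 _ hk).trans (ih.trans ((h.1 _ hd).2.2.2 _ hk).symm)
  apply List.ext_getElem?
  intro i
  by_cases hi : i < T.length
  · exact key i (h.2 i hi)
  · rw [List.getElem?_eq_none (by omega), List.getElem?_eq_none (by omega)]

end MacroScheme

section BWT

variable {α : Type*} [LinearOrder α]

/-- The matrix of the `n` circular rotations of `T`, sorted lexicographically. -/
def sortedRotations (T : List α) : List (List α) :=
  ((List.range T.length).map T.rotate).mergeSort (fun u v => decide (u ≤ v))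

/-- The Burrows-Wheeler transform of `T`: the last column of the matrix of sorted rotations. -/
def bwt (T : List α) : List α := (sortedRotations T).filterMap List.getLast?

/-- The number `r` of maximal equal-letter runs in the Burrows-Wheeler transform of `T`. -/
def bwtRuns (T : List α) : ℕ := ((bwt T).splitBy (fun a b => decide (a = b))).length

end BWT

end StringCompression

namespace StringCompression

/-! ### Phrase count from substring complexity -/

section Counting

/-! Both bounds go through substring complexity. If `T` has at most `d * k` distinct substrings of
each length `k`, then `z` is `O(d * log (2n/d))` (`lz77Size_le`), and both `b*` and `r` can serve as
`d`.

For the phrase count, consider phrases of length in `[h, 2h)`. A phrase extended by one letter has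
no earlier occurrence, so by periodicity every window of length `6h` reaching far enough to the left
of it is new (`mem_firstOccurrences`). Each phrase away from the ends of `T` thus yields `h` first
occurrences of substrings of length `6h`, of which there are at most `6dh` in all. This leaves
`O(d)` phrases per dyadic length class, and disjointness leaves at most `d` phrases longer than
about `n/d`.

For `b*`, every substring has an occurrence through the end of some left-hand side
(`exists_occurrence_lastPos`), at one of `k` offsets. For `r`, lengthening the prefixes of the
sorted rotations by one letter creates fewer than `r` new ones (`card_take_succ_lt`). -/

theorem take_drop_eq_iff {α : Type*} {T : List α} {p q k : ℕ} :
    (T.drop p).take k = (T.drop q).take k ↔ ∀ i < k, T[p + i]? = T[q + i]? := by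
  constructor
  · intro h i hi
    have := congrArg (fun l : List α => l[i]?) h
    simpa [List.getElem?_take, hi] using this
  · intro h
    apply List.ext_getElem?
    intro i
    by_cases hi : i < k
    · simpa [List.getElem?_take, hi] using h i hi
    · simp [hi]

/-- Equal windows at `q'` and `q` give `T[q'..q+k)` the period `q - q'`; any multiple of it is a
valid shift as long as it does not leave this range. -/
theorem getElem?_sub_mul_period {α : Type*} {T : List α} {q' q k : ℕ} (hq : q' < q)
    (h : (T.drop q').take k = (T.drop q).take k) (t : ℕ) :
    ∀ i, q' + t * (q - q') ≤ i → i < q + k → T[i - t * (q - q')]? = T[i]? := by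
  rw [take_drop_eq_iff] at h
  induction t with
  | zero => simp
  | succ t ih =>
    intro i hi hik
    rw [Nat.succ_mul] at hi ⊢
    have h1 := ih (i - (q - q')) (by omega) (by omega)
    have h2 := h (i - q)
    by_cases hiq : q ≤ i
    · have h2 := h2 (by omega)
      rw [show q' + (i - q) = i - (q - q') by omega, show q + (i - q) = i by omega] at h2
      rw [← h2, ← h1]
      congr 1
      omega
    · omega

variable {α : Type*} [DecidableEq α]

/-- The distinct substrings of `T` of length `k`. -/
def substrings (T : List α) (k : ℕ) : Finset (List α) :=
  (Finset.range (T.length + 1 - k)).image fun q => (T.drop q).take k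

/-- The positions at which a substring of length `k` occurs for the first time. -/
def firstOccurrences (T : List α) (k : ℕ) : Finset ℕ :=
  (Finset.range (T.length + 1 - k)).filter fun q =>
    ∀ q' < q, (T.drop q').take k ≠ (T.drop q).take k

theorem card_firstOccurrences_le (T : List α) (k : ℕ) :
    (firstOccurrences T k).card ≤ (substrings T k).card := by
  apply Finset.card_le_card_of_injOn (fun q => (T.drop q).take k)
  · intro q hq
    exact Finset.mem_image_of_mem _ (Finset.mem_filter.1 hq).1
  · intro q hq q' hq' h
    have h1 := (Finset.mem_filter.1 hq).2
    have h2 := (Finset.mem_filter.1 hq').2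
    rcases lt_trichotomy q q' with h3 | h3 | h3
    · exact absurd h (h2 _ h3)
    · exact h3
    · exact absurd h.symm (h1 _ h3)

/-- A window that contains a substring `T[p..p+m)` without occurrence in `T[0..p)`, and the `m`
letters before it, has no earlier occurrence: otherwise it would have a period by which the
substring can be moved to the left. -/
theorem mem_firstOccurrences {T : List α} {p m q k : ℕ}
    (hnew : ¬ (T.drop p).take m <:+: T.take p) (hq : q + m ≤ p) (hk : p + m ≤ q + k)
    (hn : q + k ≤ T.length) : q ∈ firstOccurrences T k := by
  refine Finset.mem_filter.2 ⟨Finset.mem_range.2 (by omega), fun q' hq' heq => hnew ?_⟩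
  -- The least multiple of the period that is at least `m`: the shift clears position `p`, but does
  -- not go left of `q'` because `q + m ≤ p`.
  obtain ⟨t, ht1, ht2⟩ : ∃ t, m ≤ t * (q - q') ∧ t * (q - q') < m + (q - q') := by
    have hpos : 0 < q - q' := by omega
    refine ⟨(m + (q - q') - 1) / (q - q'), ?_, ?_⟩
    · have := Nat.lt_div_mul_add (a := m + (q - q') - 1) hpos
      omega
    · have := Nat.div_mul_le_self (m + (q - q') - 1) (q - q')
      omega
  have h : (T.drop p).take m = (T.drop (p - t * (q - q'))).take m := by
    refine (take_drop_eq_iff.2 fun i hi => ?_).symm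
    have := getElem?_sub_mul_period hq' heq t (p + i) (by omega) (by omega)
    rw [← this]
    congr 1
    omega
  have h' : (T.drop (p - t * (q - q'))).take m
      = ((T.take p).drop (p - t * (q - q'))).take m := by
    rw [List.drop_take, List.take_take]
    congr 1
    omega
  rw [h, h']
  exact (List.take_prefix _ _).isInfix.trans (List.drop_suffix _ _).isInfix

/-- The starts and lengths of the phrases of the parse. -/
theorem exists_phrases (T w s : List α) (hT : T = w ++ s) :
    ∃ L : List (ℕ × ℕ), L.length = (lz77From w s).length ∧
      L.Pairwise (fun x y => x.1 + x.2 ≤ y.1) ∧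
      ∀ x ∈ L, w.length ≤ x.1 ∧ 1 ≤ x.2 ∧ x.1 + x.2 ≤ T.length ∧
        (x.1 + x.2 < T.length → ¬ (T.drop x.1).take (x.2 + 1) <:+: T.take x.1) := by
  induction hl : s.length using Nat.strong_induction_on generalizing w s with
  | _ N ih =>
    match s with
    | [] => exact ⟨[], by simp [lz77From], by simp, by simp⟩
    | a :: t =>
      rw [lz77From]
      set s := a :: t with hs
      have hs1 : 1 ≤ s.length := by simp [hs]
      have hle : longestPrevLength w s ≤ s.length := Nat.findGreatest_le _
      set l := max 1 (longestPrevLength w s) with hl'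
      have hl1 : 1 ≤ l := le_max_left _ _
      have hl2 : longestPrevLength w s ≤ l := le_max_right _ _
      have hls : l ≤ s.length := max_le hs1 hle
      obtain ⟨L, h1, h2, h3⟩ := ih (s.drop l).length (by simp; omega) (w ++ s.take l) (s.drop l)
        (by simp [hT]) rfl
      have hT' : T.length = w.length + s.length := by simp [hT]
      have hwl : (w ++ s.take l).length = w.length + l := by simp [hls]
      rw [hwl] at h3
      refine ⟨(w.length, l) :: L, by simp [h1], ?_, ?_⟩
      · refine List.pairwise_cons.2 ⟨fun x hx => (h3 x hx).1, h2⟩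
      · intro x hx
        rcases List.mem_cons.1 hx with rfl | hx
        · refine ⟨le_rfl, hl1, by simp only; omega, fun hlt hin => ?_⟩
          simp only at hlt hin
          have : s.take (l + 1) <:+: w := by simpa [hT] using hin
          -- Greedy maximality. Since `l` is at least the longest match, this also covers a phrase
          -- that is a single new letter.
          have := Nat.le_findGreatest (P := fun l => s.take l <:+: w) (n := s.length)
            (by omega) this
          unfold longestPrevLength at hl2
          omega
        · obtain ⟨h4, h5⟩ := h3 x hx
          exact ⟨by omega, h5⟩

/-- The first `h` positions of pairwise disjoint intervals of length at least `h` are all distinct.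
-/
theorem card_mul_le_of_disjoint {S : Finset (ℕ × ℕ)} {A : Finset ℕ} {h : ℕ}
    (hdisj : ∀ x ∈ S, ∀ y ∈ S, x ≠ y → x.1 + x.2 ≤ y.1 ∨ y.1 + y.2 ≤ x.1)
    (hlen : ∀ x ∈ S, h ≤ x.2) (hA : ∀ x ∈ S, ∀ t < h, x.1 + t ∈ A) :
    S.card * h ≤ A.card := by
  have hprod : S.card * h = (S ×ˢ Finset.range h).card := by
    rw [Finset.card_product, Finset.card_range]
  rw [hprod]
  apply Finset.card_le_card_of_injOn (fun z => z.1.1 + z.2)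
  · rintro ⟨x, t⟩ hz
    have hz := Finset.mem_product.1 (Finset.mem_coe.1 hz)
    exact hA x hz.1 t (Finset.mem_range.1 hz.2)
  · rintro ⟨x, t⟩ hz ⟨y, u⟩ hz' heq
    have hz := Finset.mem_product.1 (Finset.mem_coe.1 hz)
    have hz' := Finset.mem_product.1 (Finset.mem_coe.1 hz')
    simp only [Finset.mem_range] at hz hz' heq
    have h1 := hlen x hz.1
    have h2 := hlen y hz'.1
    by_cases hxy : x = y
    · subst hxy
      simpa using heq
    · have := hdisj x hz.1 y hz'.1 hxy
      omega

/-- Dyadic classes of phrase lengths: at most `12 * d` phrases in each of the `J` classes below `2 ^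
J`, and at most `d` phrases of length at least `2 ^ J`. -/
theorem lz77Size_le {T : List α} {d : ℕ} (hd : 1 ≤ d)
    (hsub : ∀ k, 1 ≤ k → k ≤ T.length → (substrings T k).card ≤ d * k) (J : ℕ)
    (hJ : T.length ≤ d * 2 ^ J) : lz77Size T ≤ 12 * d * J + d := by
  obtain ⟨L, h1, h2, h3⟩ := exists_phrases T [] T rfl
  have hnodup : L.Nodup := by
    apply (List.Pairwise.and_mem.1 h2).imp
    rintro x y ⟨hx, hy, hxy⟩ rfl
    have := (h3 x hx).2.1
    omega
  have hz : lz77Size T = L.toFinset.card := by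
    rw [List.toFinset_card_of_nodup hnodup, h1]
    rfl
  have hdisj : ∀ x ∈ L.toFinset, ∀ y ∈ L.toFinset, x ≠ y → x.1 + x.2 ≤ y.1 ∨ y.1 + y.2 ≤ x.1 := by
    intro x hx y hy hxy
    have h2' : L.Pairwise fun x y => x.1 + x.2 ≤ y.1 ∨ y.1 + y.2 ≤ x.1 := h2.imp Or.inl
    have : Std.Symm fun x y : ℕ × ℕ => x.1 + x.2 ≤ y.1 ∨ y.1 + y.2 ≤ x.1 := ⟨fun _ _ h => h.symm⟩
    exact h2'.forall (List.mem_toFinset.1 hx) (List.mem_toFinset.1 hy) hxy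
  have hlevel : ∀ j, (L.toFinset.filter fun x => 2 ^ j ≤ x.2 ∧ x.2 < 2 ^ (j + 1)).card ≤ 12 * d := by
    intro j
    have hpos : 0 < 2 ^ j := by positivity
    rw [pow_succ]
    generalize 2 ^ j = h at hpos
    have hF : (firstOccurrences T (6 * h)).card ≤ d * (6 * h) := by
      by_cases hk : 6 * h ≤ T.length
      · exact (card_firstOccurrences_le T _).trans (hsub _ (by omega) hk)
      · simp [firstOccurrences, show T.length + 1 - 6 * h = 0 by omega]
    -- Position `x.1 + t` is charged to the window of length `6 * h` starting `4 * h` before it. The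
    -- first two sets of `A` collect the positions whose window would stick out of `T` on the left
    -- or on the right.
    have := card_mul_le_of_disjoint (h := h)
      (S := L.toFinset.filter fun x => h ≤ x.2 ∧ x.2 < h * 2)
      (A := Finset.range (4 * h) ∪ Finset.Ico (T.length + 1 - 2 * h) T.length ∪
        (firstOccurrences T (6 * h)).image (· + 4 * h))
      (fun x hx y hy => hdisj x (Finset.mem_filter.1 hx).1 y (Finset.mem_filter.1 hy).1)
      (fun x hx => (Finset.mem_filter.1 hx).2.1) ?_
    · have hA : (Finset.range (4 * h) ∪ Finset.Ico (T.length + 1 - 2 * h) T.length ∪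
        (firstOccurrences T (6 * h)).image (· + 4 * h)).card ≤ 4 * h + 2 * h + d * (6 * h) := by
        refine (Finset.card_union_le _ _).trans (add_le_add ((Finset.card_union_le _ _).trans
          (add_le_add ?_ ?_)) (Finset.card_image_le.trans hF))
        · simp
        · simp; omega
      have h6 : 4 * h + 2 * h ≤ d * (6 * h) := by nlinarith
      refine Nat.le_of_mul_le_mul_right (c := h) ?_ hpos
      calc _ ≤ _ := this.trans hA
        _ ≤ d * (6 * h) + d * (6 * h) := by omega
        _ = _ := by ring
    · intro x hx t ht
      obtain ⟨hxL, hx1, hx2⟩ := Finset.mem_filter.1 hx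
      obtain ⟨-, -, h4, h5⟩ := h3 x (List.mem_toFinset.1 hxL)
      simp only [Finset.mem_union, Finset.mem_range, Finset.mem_Ico, Finset.mem_image]
      by_cases ha : x.1 + t < 4 * h
      · exact Or.inl (Or.inl ha)
      by_cases hb : T.length + 1 - 2 * h ≤ x.1 + t
      · exact Or.inl (Or.inr ⟨hb, by omega⟩)
      · exact Or.inr ⟨x.1 + t - 4 * h, mem_firstOccurrences (p := x.1) (m := x.2 + 1)
          (h5 (by omega)) (by omega) (by omega) (by omega), by omega⟩
  have hlong : (L.toFinset.filter fun x => 2 ^ J ≤ x.2).card ≤ d := by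
    have := card_mul_le_of_disjoint (h := 2 ^ J) (S := L.toFinset.filter fun x => 2 ^ J ≤ x.2)
      (A := Finset.range T.length)
      (fun x hx y hy => hdisj x (Finset.mem_filter.1 hx).1 y (Finset.mem_filter.1 hy).1)
      (fun x hx => (Finset.mem_filter.1 hx).2) (fun x hx t ht => by
        obtain ⟨hxL, hx1⟩ := Finset.mem_filter.1 hx
        obtain ⟨-, -, h4, -⟩ := h3 x (List.mem_toFinset.1 hxL)
        exact Finset.mem_range.2 (by omega))
    rw [Finset.card_range] at this
    exact Nat.le_of_mul_le_mul_right (this.trans hJ) (by positivity)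
  have hcover : L.toFinset ⊆ ((Finset.range J).biUnion fun j =>
      L.toFinset.filter fun x => 2 ^ j ≤ x.2 ∧ x.2 < 2 ^ (j + 1)) ∪
      L.toFinset.filter fun x => 2 ^ J ≤ x.2 := by
    intro x hx
    simp only [Finset.mem_union, Finset.mem_biUnion, Finset.mem_filter, Finset.mem_range]
    by_cases hJx : 2 ^ J ≤ x.2
    · exact Or.inr ⟨hx, hJx⟩
    · have h0 : x.2 ≠ 0 := by
        have := (h3 x (List.mem_toFinset.1 hx)).2.1
        omega
      exact Or.inl ⟨Nat.log 2 x.2, (Nat.log_lt_iff_lt_pow (by norm_num) h0).2 (by omega), hx,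
        Nat.pow_log_le_self 2 h0, Nat.lt_pow_succ_log_self (by norm_num) _⟩
  rw [hz]
  refine (Finset.card_le_card hcover).trans ((Finset.card_union_le _ _).trans
    (add_le_add (Finset.card_biUnion_le.trans ((Finset.sum_le_card_nsmul _ _ (12 * d)
      fun j _ => hlevel j).trans ?_)) hlong))
  simp [mul_comm]

/-- The Lempel-Ziv parse is small if `T` has few distinct substrings of each length. -/
theorem lz77Size_le_logb {T : List α} (hT : T ≠ []) {d : ℕ} (hdn : d ≤ T.length)
    (hsub : ∀ k, 1 ≤ k → k ≤ T.length → (substrings T k).card ≤ d * k) :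
    (lz77Size T : ℝ) ≤ 13 * ((d : ℝ) * Real.logb 2 (2 * (T.length : ℝ) / (d : ℝ)) ^ 2) := by
  have hn : 1 ≤ T.length := List.length_pos_iff.2 hT
  -- A nonempty string has a substring of length `1`.
  have hd : 1 ≤ d := by
    have h1 : 0 < (substrings T 1).card :=
      Finset.card_pos.2 (Finset.image_nonempty.2 (by simp; omega))
    have := hsub 1 le_rfl hn
    omega
  have hd0 : (0 : ℝ) < d := by exact_mod_cast hd
  have hn0 : (0 : ℝ) < T.length := by exact_mod_cast hn
  have hx : (1 : ℝ) ≤ T.length / d := by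
    rw [le_div_iff₀ hd0, one_mul]
    exact_mod_cast hdn
  have hlog : Real.logb 2 (2 * (T.length : ℝ) / d) = 1 + Real.logb 2 (T.length / d) := by
    rw [mul_div_assoc, Real.logb_mul (by norm_num) (by positivity)]
    simp
  have hlog0 : 0 ≤ Real.logb 2 ((T.length : ℝ) / d) := Real.logb_nonneg (by norm_num) hx
  have hJ := lz77Size_le hd hsub ⌈Real.logb 2 ((T.length : ℝ) / d)⌉₊ (by
    have h := Nat.le_ceil (Real.logb 2 ((T.length : ℝ) / d))
    rw [Real.logb_le_iff_le_rpow (by norm_num) (by positivity), Real.rpow_natCast,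
      div_le_iff₀ hd0] at h
    have h' : (T.length : ℝ) ≤ ((d * 2 ^ ⌈Real.logb 2 ((T.length : ℝ) / d)⌉₊ : ℕ) : ℝ) := by
      push_cast
      linarith
    exact_mod_cast h')
  have hJ' : (lz77Size T : ℝ) ≤ 12 * d * (⌈Real.logb 2 ((T.length : ℝ) / d)⌉₊ : ℝ) + d := by
    exact_mod_cast hJ
  have hceil := (Nat.ceil_lt_add_one hlog0).le
  rw [hlog]
  set y := Real.logb 2 ((T.length : ℝ) / d)
  -- The bound obtained has a single logarithm; as `1 + y ≥ 1`, squaring it only weakens the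
  -- estimate.
  calc (lz77Size T : ℝ) ≤ 12 * d * (y + 1) + d := by
        refine hJ'.trans ?_
        gcongr
    _ ≤ 13 * (d * (1 + y) ^ 2) := by nlinarith [mul_nonneg hd0.le hlog0, mul_nonneg hd0.le (sq_nonneg y)]

end Counting

/-! ### Substring complexity and macro schemes -/

section MacroSchemeSubstrings

variable {α : Type*}

/-- The position given explicitly by a directive, or the last position of its left-hand side. -/
def Directive.lastPos : Directive α → ℕ
  | .copy dst _ len => dst + len - 1
  | .literal pos _ => pos

/-- The last positions of the left-hand sides of a macro scheme form a string attractor: every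
nonempty substring has an occurrence that contains one of them. -/
theorem exists_occurrence_lastPos {D : Finset (Directive α)} {T : List α}
    (hD : ∀ d ∈ D, d.HoldsIn T) {k : ℕ} (hk : 1 ≤ k) {i : ℕ} (hi : Retrievable D i)
    (hik : i + k ≤ T.length) :
    ∃ d ∈ D, ∃ t < k, (T.drop (d.lastPos - t)).take k = (T.drop i).take k := by
  induction hi with
  | literal h => exact ⟨_, h, 0, hk, rfl⟩
  | @copy dst src len t h ht _ ih =>
    obtain ⟨h1, h2, h3, h4⟩ := hD _ h
    -- A substring inside the left-hand side is traced back to its source, where induction applies.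
    -- Otherwise it starts in the left-hand side and reaches at least its last position, so it
    -- already contains `lastPos`.
    by_cases hfit : t + k ≤ len
    · obtain ⟨d, hd, u, hu, heq⟩ := ih (by omega)
      refine ⟨d, hd, u, hu, heq.trans (take_drop_eq_iff.2 fun i hi => ?_)⟩
      rw [add_assoc, add_assoc]
      exact (h4 (t + i) (by omega)).symm
    · refine ⟨_, h, len - 1 - t, by omega, ?_⟩
      rw [show (Directive.copy dst src len : Directive α).lastPos - (len - 1 - t) = dst + t by
        simp only [Directive.lastPos]; omega]

theorem minMacroSchemeSize_le_length (T : List α) : minMacroSchemeSize T ≤ T.length := by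
  classical
  let D : Finset (Directive α) :=
    Finset.univ.image (fun i : Fin T.length => Directive.literal i.1 (T.get i))
  have hcard : D.card ≤ T.length := Finset.card_image_le.trans (by simp)
  suffices hD : IsMacroScheme D T from by
    have h : minMacroSchemeSize T ≤ D.card := Nat.sInf_le ⟨D, hD, rfl⟩
    exact h.trans hcard
  refine ⟨?_, ?_⟩
  · intro d hd
    obtain ⟨i, -, rfl⟩ := Finset.mem_image.1 hd
    simp [Directive.HoldsIn]
  · intro i hi
    exact .literal (Finset.mem_image.2 ⟨⟨i, hi⟩, Finset.mem_univ _, rfl⟩)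

variable [DecidableEq α]

theorem IsMacroScheme.card_substrings_le {D : Finset (Directive α)} {T : List α}
    (hD : IsMacroScheme D T) {k : ℕ} (hk : 1 ≤ k) (hkn : k ≤ T.length) :
    (substrings T k).card ≤ D.card * k := by
  have hsub : substrings T k ⊆ (D ×ˢ Finset.range k).image
      fun z => (T.drop (z.1.lastPos - z.2)).take k := by
    intro x hx
    obtain ⟨i, hi, rfl⟩ := Finset.mem_image.1 hx
    have hi := Finset.mem_range.1 hi
    obtain ⟨d, hd, t, ht, heq⟩ :=
      exists_occurrence_lastPos hD.1 hk (hD.2 i (by omega)) (by omega)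
    exact Finset.mem_image.2 ⟨(d, t), Finset.mem_product.2 ⟨hd, Finset.mem_range.2 ht⟩, heq⟩
  refine (Finset.card_le_card hsub).trans (Finset.card_image_le.trans ?_)
  rw [Finset.card_product, Finset.card_range]

end MacroSchemeSubstrings

/-! ### Changes between neighbouring list entries -/

section Changes

variable {β γ : Type*} [DecidableEq β] [DecidableEq γ]

/-- The number of positions at which a list differs from its next entry. -/
def changes : List β → ℕ
  | a :: b :: l => changes (b :: l) + if a = b then 0 else 1
  | _ => 0

theorem length_splitBy_loop (l : List β) (a : β) (g : List β) (acc : List (List β)) :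
    (List.splitBy.loop (fun a b => decide (a = b)) l a g acc).length
      = acc.length + changes (a :: l) + 1 := by
  induction l generalizing a g acc with
  | nil => simp [List.splitBy.loop, changes]
  | cons b l ih =>
    by_cases hab : a = b
    · simp [List.splitBy.loop, hab, ih, changes]
    · simp [List.splitBy.loop, hab, ih, changes]
      omega

theorem length_splitBy_eq {l : List β} (hl : l ≠ []) :
    (l.splitBy fun a b => decide (a = b)).length = changes l + 1 := by
  obtain ⟨a, l, rfl⟩ := List.exists_cons_of_ne_nil hl
  simp [List.splitBy, length_splitBy_loop]

theorem changes_lt_length {l : List β} (hl : l ≠ []) : changes l < l.length := by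
  induction l with
  | nil => exact absurd rfl hl
  | cons a l ih =>
    cases l with
    | nil => simp [changes]
    | cons b l =>
      have := ih (by simp)
      simp only [changes, List.length_cons] at this ⊢
      split_ifs <;> omega

theorem card_toFinset_le_changes (l : List β) : l.toFinset.card ≤ changes l + 1 := by
  induction l with
  | nil => simp
  | cons a l ih =>
    cases l with
    | nil => simp [changes]
    | cons b l =>
      simp only [changes]
      split_ifs with h
      · subst h
        simpa using ih
      · rw [List.toFinset_cons]
        exact (Finset.card_insert_le _ _).trans (by omega)

/-- A pair changes only where one of its coordinates does. -/
theorem changes_map_prodMk_le {δ : Type*} (f : δ → β) (g : δ → γ) (l : List δ) :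
    changes (l.map fun x => (f x, g x)) ≤ changes (l.map f) + changes (l.map g) := by
  induction l with
  | nil => simp [changes]
  | cons a l ih =>
    cases l with
    | nil => simp [changes]
    | cons b l =>
      simp only [List.map_cons, changes, Prod.mk.injEq] at ih ⊢
      by_cases h1 : f a = f b <;> by_cases h2 : g a = g b <;> simp [h1, h2] <;> omega

/-- In a sorted list equal entries are contiguous, so each change brings a value not met before. -/
theorem changes_lt_card_toFinset {β : Type*} [PartialOrder β] [DecidableEq β] {l : List β} (hl : l ≠ [])
    (hsorted : l.Pairwise (· ≤ ·)) : changes l < l.toFinset.card := by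
  induction l with
  | nil => exact absurd rfl hl
  | cons a l ih =>
    cases l with
    | nil => simp [changes]
    | cons b l =>
      obtain ⟨h1, h2⟩ := List.pairwise_cons.1 hsorted
      have := ih (by simp) h2
      simp only [changes]
      split_ifs with h
      · subst h
        simpa using this
      · rw [List.toFinset_cons, Finset.card_insert_of_notMem]
        · omega
        · intro hmem
          rcases List.mem_cons.1 (List.mem_toFinset.1 hmem) with h3 | h3
          · exact h h3
          · exact h (le_antisymm (h1 b (by simp)) ((List.pairwise_cons.1 h2).1 a h3))

end Changes

/-! ### Substring complexity and BWT runs -/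

section BWTSubstrings

variable {α : Type*} [LinearOrder α]

theorem take_le_take_of_le (k : ℕ) {u v : List α} (h : u ≤ v) : u.take k ≤ v.take k := by
  rw [← not_lt] at h ⊢
  induction k generalizing u v with
  | zero => simp
  | succ k ih =>
    cases v with
    | nil => cases u <;> simp at h ⊢
    | cons b v =>
      cases u with
      | nil => simp
      | cons a u =>
        rw [List.take_succ_cons, List.take_succ_cons]
        rw [List.cons_lt_cons_iff] at h ⊢
        exact fun h' => h (h'.imp_right fun h' => ⟨h'.1, not_not.1 fun h'' => ih h'' h'.2⟩)

theorem sortedRotations_perm (T : List α) :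
    (sortedRotations T).Perm ((List.range T.length).map T.rotate) :=
  List.mergeSort_perm _ _

theorem mem_sortedRotations {T x : List α} :
    x ∈ sortedRotations T ↔ ∃ i < T.length, T.rotate i = x := by
  simp [(sortedRotations_perm T).mem_iff]

theorem rotate_mem_sortedRotations {T : List α} (hT : T ≠ []) (i : ℕ) :
    T.rotate i ∈ sortedRotations T :=
  mem_sortedRotations.2 ⟨i % T.length, Nat.mod_lt _ (List.length_pos_iff.2 hT), by simp⟩

theorem pairwise_sortedRotations (T : List α) : (sortedRotations T).Pairwise (· ≤ ·) := by
  have := List.pairwise_mergeSort (le := fun u v : List α => decide (u ≤ v))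
    (by simpa using fun a b c => le_trans) (by simpa using le_total)
    ((List.range T.length).map T.rotate)
  simpa [sortedRotations] using this

/-- No rotation is empty, so `filterMap` drops no row, and runs can be counted directly on the
sorted rows. -/
theorem map_some_bwt (T : List α) :
    (bwt T).map some = (sortedRotations T).map List.getLast? := by
  have h : ∀ x ∈ sortedRotations T, x ≠ [] := by
    rintro x hx rfl
    obtain ⟨i, hi, h⟩ := mem_sortedRotations.1 hx
    simp only [List.rotate_eq_nil_iff] at h
    simp [h] at hi
  unfold bwt
  generalize sortedRotations T = l at h
  induction l with
  | nil => simp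
  | cons x l ih =>
    have hx := h x (by simp)
    rw [List.filterMap_cons, List.getLast?_eq_getLast_of_ne_nil hx]
    simp [ih fun y hy => h y (by simp [hy]), List.getLast?_eq_getLast_of_ne_nil hx]

theorem changes_map_some (l : List α) : changes (l.map some) = changes l := by
  induction l with
  | nil => simp [changes]
  | cons a l ih =>
    cases l with
    | nil => simp [changes]
    | cons b l => simpa [changes] using ih

theorem length_bwt (T : List α) : (bwt T).length = T.length := by
  rw [← List.length_map (f := some), map_some_bwt, List.length_map,
    (sortedRotations_perm T).length_eq]
  simp

theorem bwt_ne_nil {T : List α} (hT : T ≠ []) : bwt T ≠ [] := by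
  rw [← List.length_pos_iff, length_bwt]
  exact List.length_pos_iff.2 hT

theorem bwtRuns_eq {T : List α} (hT : T ≠ []) :
    bwtRuns T = changes ((sortedRotations T).map List.getLast?) + 1 := by
  rw [bwtRuns, length_splitBy_eq (bwt_ne_nil hT), ← map_some_bwt, changes_map_some]

theorem bwtRuns_le_length {T : List α} (hT : T ≠ []) : bwtRuns T ≤ T.length := by
  rw [bwtRuns, length_splitBy_eq (bwt_ne_nil hT), ← length_bwt T]
  exact changes_lt_length (bwt_ne_nil hT)

/-- The number of distinct prefixes of length `k` of the rotations of `T` grows by less than the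
number of runs when `k` grows by one: a prefix of length `k + 1` consists of the last letter and a
prefix of length `k` of another rotation. -/
theorem card_take_succ_lt {T : List α} (hT : T ≠ []) {k : ℕ} (hk : k < T.length) :
    ((sortedRotations T).map (List.take (k + 1))).toFinset.card
      < ((sortedRotations T).map (List.take k)).toFinset.card + bwtRuns T := by
  have hne : sortedRotations T ≠ [] := List.ne_nil_of_mem (rotate_mem_sortedRotations hT 0)
  have hsub : ((sortedRotations T).map (List.take (k + 1))).toFinset ⊆
      ((sortedRotations T).map fun x => (x.getLast?, x.take k)).toFinset.image
        fun z => z.1.toList ++ z.2 := by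
    intro y hy
    obtain ⟨x, hx, rfl⟩ := List.mem_map.1 (List.mem_toFinset.1 hy)
    obtain ⟨i, hi, rfl⟩ := mem_sortedRotations.1 hx
    have hr : T.rotate i ≠ [] := by simpa using hT
    refine Finset.mem_image.2 ⟨((T.rotate (i + 1)).getLast?, (T.rotate (i + 1)).take k),
      List.mem_toFinset.2 (List.mem_map.2 ⟨_, rotate_mem_sortedRotations hT _, rfl⟩), ?_⟩
    -- One more rotation moves the first letter to the end, so the prefix of length `k + 1` can be
    -- read off the next rotation.
    rw [← List.rotate_rotate]
    have hlen := List.length_rotate T i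
    obtain ⟨c, u, hcu⟩ := List.exists_cons_of_ne_nil hr
    rw [hcu] at hlen ⊢
    rw [List.length_cons] at hlen
    simp [List.take_append_of_le_length (show k ≤ u.length by omega)]
  have hsorted : ((sortedRotations T).map (List.take k)).Pairwise (· ≤ ·) :=
    (pairwise_sortedRotations T).map _ fun _ _ h => take_le_take_of_le k h
  have h1 := (Finset.card_le_card hsub).trans Finset.card_image_le
  -- Down the sorted rows, the last letter changes `bwtRuns T - 1` times, and the prefix of length
  -- `k`, being sorted too, changes fewer times than it has values. So the pairs take fewer values
  -- than the sum of the two counts.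
  have h2 := card_toFinset_le_changes ((sortedRotations T).map fun x => (x.getLast?, x.take k))
  have h3 := changes_map_prodMk_le List.getLast? (List.take k) (sortedRotations T)
  have h4 := changes_lt_card_toFinset (by simpa using hne) hsorted
  rw [bwtRuns_eq hT]
  omega

theorem card_take_le {T : List α} (hT : T ≠ []) (k : ℕ) (hk : k + 1 ≤ T.length) :
    ((sortedRotations T).map (List.take (k + 1))).toFinset.card ≤ bwtRuns T * (k + 1) := by
  induction k with
  | zero =>
    have h0 : ((sortedRotations T).map (List.take 0)).toFinset.card ≤ 1 := by
      refine Finset.card_le_one.2 fun a ha b hb => ?_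
      simp at ha hb
      rw [ha.2, hb.2]
    have := card_take_succ_lt hT hk
    omega
  | succ k ih =>
    have := card_take_succ_lt hT hk
    have := ih (by omega)
    rw [Nat.mul_succ]
    omega

theorem card_substrings_le_bwtRuns {T : List α} (hT : T ≠ []) {k : ℕ} (hk : 1 ≤ k)
    (hkn : k ≤ T.length) : (substrings T k).card ≤ bwtRuns T * k := by
  obtain ⟨k, rfl⟩ := Nat.exists_eq_add_of_le' hk
  refine (Finset.card_le_card fun x hx => ?_).trans (card_take_le hT k hkn)
  obtain ⟨i, hi, rfl⟩ := Finset.mem_image.1 hx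
  have hi := Finset.mem_range.1 hi
  refine List.mem_toFinset.2 (List.mem_map.2 ⟨_, rotate_mem_sortedRotations hT i, ?_⟩)
  -- A substring at `i` that ends within `T` is a prefix of the rotation by `i`, with no
  -- wrap-around.
  rw [List.rotate_eq_drop_append_take (by omega), List.take_append_of_le_length (by simp; omega)]

end BWTSubstrings

end StringCompression

open StringCompression in
theorem mainTheorem3 :
    (∃ C : ℝ, 0 < C ∧ ∀ (α : Type*) [DecidableEq α] (T : List α), T ≠ [] →
      (lz77Size T : ℝ) ≤ C * ((minMacroSchemeSize T : ℝ) *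
        Real.logb 2 (2 * (T.length : ℝ) / (minMacroSchemeSize T : ℝ)) ^ 2)) ∧
    (∃ C : ℝ, 0 < C ∧ ∀ (α : Type*) [LinearOrder α] (T : List α), T ≠ [] →
      (lz77Size T : ℝ) ≤ C * ((bwtRuns T : ℝ) *
        Real.logb 2 (2 * (T.length : ℝ) / (bwtRuns T : ℝ)) ^ 2)) := by
  refine ⟨⟨13, by norm_num, fun α _ T hT => ?_⟩, ⟨13, by norm_num, fun α _ T hT => ?_⟩⟩
  · obtain ⟨D, hD, hcard⟩ := exists_isMacroScheme_card_eq T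
    exact lz77Size_le_logb hT (minMacroSchemeSize_le_length T)
      fun k hk hkn => hcard ▸ hD.card_substrings_le hk hkn
  · exact lz77Size_le_logb hT (bwtRuns_le_length hT)
      fun k hk hkn => card_substrings_le_bwtRuns hT hk hkn
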